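/- Let $G$ be a finite simple graph embedded in the plane ($G$ need not be connected). Two faces of the embedding are called adjacent if some edge has one of them on one side and the other one on the other side. Suppose that the embedding has a base face, that is, a face $o$ that is adjacent to every other face (a planar graph with such an embedding is called a based planar graph). Let $\mathrm{fvs}(G)$ be the minimum size of a set $S$ of vertices such that $G\setminus S$ is a forest, and let $\mathrm{fp}(G)$ be the maximum number of faces of the embedding, all different from $o$, whose boundaries are pairwise vertex-disjoint. Then $$\mathrm{fvs}(G)\le 2\,\mathrm{fp}(G).$$ -/

import Mathlib

/-- A graph `G` drawn on closed oriented surfaces, described combinatorially, with the set `F` of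
its faces.  `rot` is the rotation at the vertices: it sends a dart (oriented edge) to the next dart
with the same tail, and goes once around each vertex.  The facial walks are the orbits of
`d ↦ rot d.symm`.  `face d` is the face along whose boundary the dart `d` runs, and an isolated
vertex lies on the boundary of exactly one face, `isolatedFace`.  Several facial walks and isolated
vertices may belong to one face, as happens in drawings of disconnected graphs. -/
structure FacedMap {V : Type*} (G : SimpleGraph V) (F : Type*) where
  rot : Equiv.Perm G.Dart
  rot_fst : ∀ d : G.Dart, (rot d).fst = d.fst
  rot_sameCycle : ∀ d d' : G.Dart, d.fst = d'.fst → rot.SameCycle d d'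
  face : G.Dart → F
  face_next : ∀ d : G.Dart, face (rot d.symm) = face d
  isolatedFace : {v : V // ∀ w, ¬ G.Adj v w} → F

namespace FacedMap

/-- The vertex `v` lies on the boundary of the face `f`. -/
def Incident {V : Type*} {G : SimpleGraph V} {F : Type*} (M : FacedMap G F) (v : V) (f : F) :
    Prop :=
  (∃ d : G.Dart, d.fst = v ∧ M.face d = f) ∨
    ∃ h : ∀ w, ¬ G.Adj v w, M.isolatedFace ⟨v, h⟩ = f

/-- The bipartite vertex-face incidence graph. -/
def incidenceGraph {V : Type*} {G : SimpleGraph V} {F : Type*} (M : FacedMap G F) :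
    SimpleGraph (V ⊕ F) :=
  SimpleGraph.fromRel fun a b => ∃ v f, a = Sum.inl v ∧ b = Sum.inr f ∧ M.Incident v f

end FacedMap

/-- An embedding of a finite graph `G` in the plane (equivalently, in the sphere) with set of
faces `F`, given combinatorially by its rotations and faces.  `G` need not be connected.

A drawing in the sphere has a connected incidence graph and satisfies Euler's formula
`|V| - |E| + |F| = 1 + c`, with `c` the number of components.  Conversely these two properties
characterise the sphere.  With `W` the number of facial walks and isolated vertices and `g` the
sum of the genera of the components, `|V| - |E| + W = 2c - 2g`, and Euler's formula turns into
`|F| + c - 1 = W + 2g`.  Connectedness of the graph formed by the `c` components and the `|F|`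
faces, with the `W` walks as edges, gives `|F| + c - 1 ≤ W`.  So `g = 0`, and that graph is a tree,
which says that the components, each drawn in a sphere, are placed in faces of one another. -/
structure PlaneEmbedding {V : Type*} (G : SimpleGraph V) (F : Type*) extends FacedMap G F where
  connected : toFacedMap.incidenceGraph.Connected
  euler : Nat.card V + Nat.card F = Nat.card G.edgeSet + Nat.card G.ConnectedComponent + 1

namespace PlaneEmbedding

/-- Two faces are adjacent if some edge has one of them on one side and the other on the other. -/
def FaceAdj {V : Type*} {G : SimpleGraph V} {F : Type*} (M : PlaneEmbedding G F) (f g : F) : Prop :=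
  ∃ d : G.Dart, M.face d = f ∧ M.face d.symm = g

/-- The face `o` is adjacent to every other face. -/
def IsBase {V : Type*} {G : SimpleGraph V} {F : Type*} (M : PlaneEmbedding G F) (o : F) : Prop :=
  ∀ f : F, f ≠ o → M.FaceAdj o f

/-- A set of faces with pairwise disjoint sets of boundary vertices.  The base face `o` is never
selected. -/
def IsFacePacking {V : Type*} {G : SimpleGraph V} {F : Type*} (M : PlaneEmbedding G F) (o : F)
    (P : Finset F) : Prop :=
  o ∉ P ∧ ∀ f ∈ P, ∀ g ∈ P, f ≠ g → Disjoint {v | M.Incident v f} {v | M.Incident v g}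

/-- The maximum size of a face packing. -/
noncomputable def fp {V : Type*} {G : SimpleGraph V} {F : Type*} (M : PlaneEmbedding G F)
    (o : F) : ℕ :=
  sSup {n : ℕ | ∃ P : Finset F, M.IsFacePacking o P ∧ P.card = n}

end PlaneEmbedding

namespace SimpleGraph

/-- A set of vertices whose deletion leaves a forest. -/
def IsFeedbackVertexSet {V : Type*} (G : SimpleGraph V) (S : Finset V) : Prop :=
  (G.induce {v | v ∉ S}).IsAcyclic

/-- The minimum size of a feedback vertex set. -/
noncomputable def fvs {V : Type*} (G : SimpleGraph V) : ℕ :=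
  sInf {n : ℕ | ∃ S : Finset V, G.IsFeedbackVertexSet S ∧ S.card = n}

end SimpleGraph

/-! Each face `f ≠ o` gets an edge `e f` shared with `o`. These edges form a spanning star in the
dual, so by Euler's formula deleting them leaves a forest `T` (`cut_isAcyclic`). The facial walk of
`f` through `e f`, without that edge, runs in `T`, so its vertices span a subtree. Subtrees of a
forest satisfy packing-covering duality (`exists_packing_covering`): some faces `P` have disjoint
subtrees, and one point `t j` per `j ∈ P` meets all subtrees. By `mem_facialSet` the faces in `P`
then have disjoint boundaries.

The points `t j` and the tails of the `e j`, for `j ∈ P`, form a feedback vertex set. A cycle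
avoiding them has a face `g` inside, and some `t j` lies on `g`. All faces around `t j` are on one
side, so `j` is inside too. As `o` is outside, `e j` is on the cycle, and so is its tail. -/

namespace SimpleGraph

/-! ### Forests: leaves, cycles modulo two, edge counts. -/

theorem IsAcyclic.exists_forall_adj_eq {V : Type*} [Finite V] [Nonempty V] {H : SimpleGraph V}
    (hH : H.IsAcyclic) : ∃ v, ∀ a b, H.Adj v a → H.Adj v b → a = b := by
  classical
  -- An end of a longest path works: a neighbour off the path would extend it.
  obtain ⟨u, v, p, hp, hmax⟩ := Walk.exists_isPath_forall_isPath_length_le_length H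
  refine ⟨u, ?_⟩
  have key : ∀ w, H.Adj u w → w = p.snd := by
    intro w hadj
    apply hH.eq_snd_of_adj_start hp hadj
    have : ¬(p.cons hadj.symm).IsPath := fun h => by
      have := hmax _ _ _ h
      simp at this
    grind [hp.cons]
  intro a b ha hb
  rw [key a ha, key b hb]

/-- A nonempty finite set of vertices of a forest contains a vertex with at most one neighbour
in the set. -/
theorem IsAcyclic.exists_mem_forall_adj_eq {V : Type*} {H : SimpleGraph V}
    (hH : H.IsAcyclic) {W : Set V} (hf : W.Finite) (hn : W.Nonempty) :
    ∃ v ∈ W, ∀ a ∈ W, ∀ b ∈ W, H.Adj v a → H.Adj v b → a = b := by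
  have := hf.to_subtype
  have := hn.to_subtype
  obtain ⟨v, hv⟩ := (hH.induce W).exists_forall_adj_eq
  refine ⟨v, v.2, fun a ha b hb hva hvb => ?_⟩
  have := hv ⟨a, ha⟩ ⟨b, hb⟩ hva hvb
  simpa using this

/-- A forest carries no nonzero cycle modulo two. -/
theorem IsAcyclic.eq_zero_of_sum_eq_zero {V : Type*} [Fintype V] {H : SimpleGraph V}
    (hH : H.IsAcyclic) (z : V → V → ZMod 2) (hsymm : ∀ v w, z v w = z w v)
    (hsupp : ∀ v w, z v w ≠ 0 → H.Adj v w) (hsum : ∀ v, ∑ w, z v w = 0) (v w : V) :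
    z v w = 0 := by
  by_contra hvw
  obtain ⟨a, ⟨b, hab⟩, h⟩ := hH.exists_mem_forall_adj_eq (W := {v | ∃ w, z v w ≠ 0})
    (Set.toFinite _) ⟨v, w, hvw⟩
  have hmem : ∀ c, z a c ≠ 0 → c ∈ {v | ∃ w, z v w ≠ 0} := fun c hc => ⟨a, by rwa [← hsymm]⟩
  refine hab ?_
  -- At a leaf `a` of the support, the sum has a single nonzero term.
  rw [← hsum a]
  symm
  apply Fintype.sum_eq_single
  intro c hc
  by_contra hac
  exact hc (h c (hmem c hac) b (hmem b hab) (hsupp _ _ hac) (hsupp _ _ hab))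

/-- The number of vertices is at most the number of edges plus the number of components. -/
theorem card_le_card_edgeSet_add_card_connectedComponent {V : Type*} [Finite V]
    (H : SimpleGraph V) :
    Nat.card V ≤ Nat.card H.edgeSet + Nat.card H.ConnectedComponent := by
  classical
  let r : V → V := fun v => (H.connectedComponentMk v).out
  have hr : ∀ v, H.Reachable v (r v) := fun v =>
    (ConnectedComponent.exact (Quot.out_eq (H.connectedComponentMk v))).symm
  have hrr : ∀ v w, H.Adj v w → r v = r w := fun v w h => by
    simp only [r]
    rw [ConnectedComponent.sound h.reachable]
  have hnext : ∀ v, v ≠ r v → ∃ w, H.Adj v w ∧ H.dist w (r v) < H.dist v (r v) := by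
    intro v hv
    obtain ⟨p, hp⟩ := (hr v).exists_walk_length_eq_dist
    have key : ∀ (x : V) (p : H.Walk v x), v ≠ x → p.length = H.dist v x →
        ∃ w, H.Adj v w ∧ H.dist w x < H.dist v x := by
      intro x p hvx hp
      cases p with
      | nil => exact absurd rfl hvx
      | cons h q =>
        refine ⟨_, h, ?_⟩
        rw [← hp]
        exact lt_of_le_of_lt (dist_le q) (by simp)
    exact key _ p hv hp
  choose! n hn hlt using hnext
  rw [← Nat.card_sum]
  -- A non-root goes to the first edge towards its root, a root to its component. Two ends of one
  -- edge cannot each be closer to the root than the other.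
  let φ : V → H.edgeSet ⊕ H.ConnectedComponent := fun v =>
    if h : v ≠ r v then Sum.inl ⟨s(v, n v), hn v h⟩ else Sum.inr (H.connectedComponentMk v)
  apply Nat.card_le_card_of_injective φ
  intro v w hvw
  by_cases hv : v = r v <;> by_cases hw : w = r w
  · simp only [φ, ne_eq, ← hv, ← hw, not_true_eq_false, dite_false, Sum.inr.injEq] at hvw
    rw [hv, hw]
    simp only [r, hvw]
  · simp [φ, ← hv, hw] at hvw
  · simp [φ, hv, ← hw] at hvw
  · simp only [φ, ne_eq, hv, hw, not_false_eq_true, dite_true, Sum.inl.injEq] at hvw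
    have hvw := Sym2.eq_iff.1 (congrArg Subtype.val hvw)
    obtain h | ⟨h1, h2⟩ := hvw
    · exact h.1
    · exfalso
      have a := hlt v hv
      have b := hlt w hw
      have hrvw : r v = r w := by rw [h1]; exact (hrr _ _ (hn w hw)).symm
      rw [h2, hrvw] at a
      rw [← h1] at b
      omega

theorem card_connectedComponent_le_of_reachable {V : Type*} [Finite V] {H H' : SimpleGraph V}
    (hle : H' ≤ H) (h : ∀ a b, H.Adj a b → H'.Reachable a b) :
    Nat.card H'.ConnectedComponent ≤ Nat.card H.ConnectedComponent := by
  have hreach : ∀ a b, H.Reachable a b → H'.Reachable a b := by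
    rintro a b ⟨p⟩
    induction p with
    | nil => rfl
    | cons hac p ih => exact (h _ _ hac).trans ih
  apply Nat.card_le_card_of_injective (ConnectedComponent.map (Hom.ofLE hle))
  intro a b
  induction a using ConnectedComponent.ind
  induction b using ConnectedComponent.ind
  intro hab
  exact ConnectedComponent.sound (hreach _ _ (ConnectedComponent.exact hab))

/-- A graph with few enough edges and components is a forest. -/
theorem isAcyclic_of_card_edgeSet_add_card_le {V : Type*} [Finite V] {H : SimpleGraph V}
    (h : Nat.card H.edgeSet + Nat.card H.ConnectedComponent ≤ Nat.card V) : H.IsAcyclic := by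
  rw [isAcyclic_iff_forall_adj_isBridge]
  intro v w hvw
  by_contra hb
  -- Deleting a non-bridge loses an edge but creates no component, against the general bound.
  set H' := H.deleteEdges {s(v, w)} with hH'
  have h1 := card_le_card_edgeSet_add_card_connectedComponent H'
  have hreach : H'.Reachable v w := by
    rw [isBridge_iff] at hb
    simpa [H', hvw, deleteEdges] using hb
  have h2 : Nat.card H'.edgeSet < Nat.card H.edgeSet := by
    apply Set.ncard_lt_ncard _ (Set.toFinite _)
    rw [hH', edgeSet_deleteEdges]
    exact Set.sdiff_singleton_ssubset.2 hvw
  have h3 : Nat.card H'.ConnectedComponent ≤ Nat.card H.ConnectedComponent := by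
    apply card_connectedComponent_le_of_reachable (deleteEdges_le _)
    intro a c hac
    by_cases he : s(a, c) = s(v, w)
    · rw [Sym2.eq_iff] at he
      obtain ⟨rfl, rfl⟩ | ⟨rfl, rfl⟩ := he
      · exact hreach
      · exact hreach.symm
    · exact Adj.reachable (by simp [deleteEdges_adj, hac, he])
  omega

/-! ### Duality for subtrees of a forest. -/

/-- `R` is connected in `T`: a nonempty subset closed under adjacency within `R` is all of `R`. -/
def ConnectedOn {V : Type*} (T : SimpleGraph V) (R : Set V) : Prop :=
  ∀ A ⊆ R, A.Nonempty → (∀ a ∈ A, ∀ b ∈ R, T.Adj a b → b ∈ A) → R ⊆ A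

/-- Packing and covering duality for subtrees of a forest. -/
theorem IsAcyclic.exists_packing_covering {V ι : Type*} [Nonempty V] {T : SimpleGraph V}
    (hT : T.IsAcyclic) (W : Finset V) (I : Set ι) (R : ι → Set V)
    (hR : ∀ i ∈ I, R i ⊆ W ∧ (R i).Nonempty ∧ T.ConnectedOn (R i)) :
    ∃ (P : Finset ι) (t : ι → V), ↑P ⊆ I ∧ (∀ i ∈ P, t i ∈ R i) ∧
      (∀ i ∈ P, ∀ j ∈ P, i ≠ j → Disjoint (R i) (R j)) ∧ ∀ i ∈ I, ∃ j ∈ P, t j ∈ R i := by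
  classical
  induction hn : W.card generalizing W I R with
  | zero =>
    refine ⟨∅, fun _ => Classical.arbitrary V, by simp, by simp, by simp, fun i hi => ?_⟩
    obtain ⟨x, hx⟩ := (hR i hi).2.1
    have := (hR i hi).1 hx
    simp [Finset.card_eq_zero.1 hn] at this
  | succ n ih =>
    obtain ⟨v, hvW, hv⟩ := hT.exists_mem_forall_adj_eq W.finite_toSet
      (Finset.card_pos.1 (by omega))
    have hcard : (W.erase v).card = n := by rw [Finset.card_erase_of_mem hvW, hn]; rfl
    -- Remove the leaf `v`. If `{v}` is one of the sets, pack it, choose the point `v`, and recurse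
    -- on the sets avoiding `v`.
    by_cases hs : ∃ i ∈ I, R i = {v}
    · obtain ⟨i, hi, hiv⟩ := hs
      obtain ⟨P, t, hPI, ht, hdis, hcov⟩ := ih (W.erase v) {j ∈ I | v ∉ R j} R
        (fun j hj => ⟨fun x hx => by
          have := (hR j hj.1).1 hx
          have : x ≠ v := fun h => hj.2 (h ▸ hx)
          simp_all, (hR j hj.1).2⟩) hcard
      have hiP : ∀ j ∈ P, j ≠ i := by
        rintro j hj rfl
        exact (hPI hj).2 (by simp [hiv])
      refine ⟨insert i P, Function.update t i v, ?_, ?_, ?_, ?_⟩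
      · intro j hj
        rcases Finset.mem_insert.1 hj with rfl | hj
        · exact hi
        · exact (hPI hj).1
      · intro j hj
        rcases Finset.mem_insert.1 hj with rfl | hj
        · simp [hiv]
        · rw [Function.update_of_ne (hiP j hj)]
          exact ht j hj
      · intro j hj k hk hjk
        rcases Finset.mem_insert.1 hj with hji | hjP <;>
          rcases Finset.mem_insert.1 hk with hki | hkP
        · exact absurd (hji.trans hki.symm) hjk
        · rw [hji, hiv, Set.disjoint_singleton_left]
          exact (hPI hkP).2
        · rw [hki, hiv, Set.disjoint_singleton_right]
          exact (hPI hjP).2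
        · exact hdis j hjP k hkP hjk
      · intro j hj
        by_cases hvj : v ∈ R j
        · exact ⟨i, by simp, by simpa using hvj⟩
        · obtain ⟨k, hk, hkj⟩ := hcov j ⟨hj, hvj⟩
          exact ⟨k, by simp [hk], by rwa [Function.update_of_ne (hiP k hk)]⟩
    · push Not at hs
      -- Otherwise every set through `v` contains its only neighbour in `W`, so erasing `v` keeps
      -- sets nonempty and connected and makes no intersecting sets disjoint.
      have hnb : ∀ i ∈ I, v ∈ R i → ∃ u ∈ R i, T.Adj v u := by
        intro i hi hvi
        by_contra! hno
        apply hs i hi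
        apply Set.Subset.antisymm _ (by simpa using hvi)
        apply (hR i hi).2.2 {v} (by simpa using hvi) (by simp)
        rintro a rfl b hb hab
        exact absurd hab (hno b hb)
      have huniq : ∀ i ∈ I, ∀ j ∈ I, ∀ a ∈ R i, ∀ b ∈ R j, T.Adj v a → T.Adj v b → a = b :=
        fun i hi j hj a ha b hb => hv a ((hR i hi).1 ha) b ((hR j hj).1 hb)
      obtain ⟨P, t, hPI, ht, hdis, hcov⟩ := ih (W.erase v) I (fun i => R i \ {v}) (by
        intro i hi
        refine ⟨fun x hx => ?_, ?_, ?_⟩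
        · have := (hR i hi).1 hx.1
          have := hx.2
          simp_all
        · obtain ⟨x, hx⟩ := (hR i hi).2.1
          by_cases hxv : x = v
          · obtain ⟨u, hu, hvu⟩ := hnb i hi (hxv ▸ hx)
            exact ⟨u, hu, hvu.ne'⟩
          · exact ⟨x, hx, hxv⟩
        · intro A hA hne hcl
          have hAv : v ∉ A := fun h => (hA h).2 rfl
          by_cases hu : ∃ u ∈ A, T.Adj v u
          · obtain ⟨u, huA, hvu⟩ := hu
            by_cases hvi : v ∈ R i
            · have := (hR i hi).2.2 (insert v A)
                (Set.insert_subset hvi fun x hx => (hA hx).1) (by simp) (by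
                rintro a (rfl | ha) b hb hab
                · rw [huniq i hi i hi b hb u (hA huA).1 hab hvu]
                  simp [huA]
                · by_cases hbv : b = v
                  · simp [hbv]
                  · exact Or.inr (hcl a ha b ⟨hb, hbv⟩ hab))
              rintro x ⟨hx, hxv⟩
              exact (this hx).resolve_left hxv
            · rw [Set.sdiff_singleton_eq_self hvi] at *
              exact (hR i hi).2.2 A hA hne hcl
          · push Not at hu
            have := (hR i hi).2.2 A (fun x hx => (hA hx).1) hne (fun a ha b hb hab =>
              hcl a ha b ⟨hb, by rintro rfl; exact hu a ha hab.symm⟩ hab)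
            exact fun x hx => this hx.1) hcard
      refine ⟨P, t, hPI, fun i hi => (ht i hi).1, ?_, ?_⟩
      · intro i hi j hj hij
        have := hdis i hi j hj hij
        rw [Set.disjoint_left] at this ⊢
        intro x hxi hxj
        by_cases hxv : x = v
        · subst hxv
          obtain ⟨u, hu, hxu⟩ := hnb i (hPI hi) hxi
          obtain ⟨w, hw, hxw⟩ := hnb j (hPI hj) hxj
          have := huniq i (hPI hi) j (hPI hj) u hu w hw hxu hxw
          subst this
          exact this ⟨hu, hxu.ne'⟩ ⟨hw, hxu.ne'⟩
        · exact this ⟨hxi, hxv⟩ ⟨hxj, hxv⟩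
      · intro i hi
        obtain ⟨j, hj, hji⟩ := hcov i hi
        exact ⟨j, hj, hji.1⟩

end SimpleGraph

/-! ### Facial walks and cycles modulo two. -/

namespace FacedMap

variable {V F : Type*} {G : SimpleGraph V} (M : FacedMap G F)

/-- The permutation of the darts whose orbits are the facial walks. -/
def facialPerm : Equiv.Perm G.Dart :=
  (SimpleGraph.Dart.symm_involutive (G := G)).toPerm.trans M.rot

theorem facialPerm_apply (d : G.Dart) : M.facialPerm d = M.rot d.symm := rfl

theorem facialPerm_fst (d : G.Dart) : (M.facialPerm d).fst = d.snd := M.rot_fst d.symm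

theorem face_rot (d : G.Dart) : M.face (M.rot d) = M.face d.symm := by
  simpa using M.face_next d.symm

theorem face_eq_of_sameCycle {d d' : G.Dart} (h : M.facialPerm.SameCycle d d') :
    M.face d = M.face d' := by
  have key : ∀ (n : ℕ) d, M.face ((M.facialPerm ^ n) d) = M.face d := by
    intro n
    induction n with
    | zero => simp
    | succ n ih =>
      intro d
      rw [pow_succ, Equiv.Perm.mul_apply, ih, facialPerm_apply, M.face_next]
  obtain ⟨n, rfl⟩ := h
  obtain ⟨k, rfl | rfl⟩ := n.eq_nat_or_neg
  · exact_mod_cast (key k d).symm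
  · have := key k ((M.facialPerm ^ (-(k : ℤ))) d)
    rw [← Equiv.Perm.mul_apply, ← zpow_natCast, ← zpow_add, add_neg_cancel] at this
    exact this

/-- A property of darts preserved by the rotation at `v` spreads to all darts at `v`. -/
theorem rot_induction [Finite V] {v : V} {p : G.Dart → Prop}
    (h : ∀ d, d.fst = v → p d → p (M.rot d)) {d d' : G.Dart} (hd : d.fst = v) (hd' : d'.fst = v)
    (hp : p d) : p d' := by
  have : Finite G.Dart := Finite.of_injective _ SimpleGraph.Dart.toProd_injective
  obtain ⟨n, -, rfl⟩ := (M.rot_sameCycle d d' (hd.trans hd'.symm)).exists_pow_eq'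
  have key : ∀ n : ℕ, ((M.rot ^ n) d).fst = v ∧ p ((M.rot ^ n) d) := by
    intro n
    induction n with
    | zero => exact ⟨hd, hp⟩
    | succ n ih =>
      rw [pow_succ', Equiv.Perm.mul_apply]
      exact ⟨(M.rot_fst _).trans ih.1, h _ ih.1 ih.2⟩
  exact (key n).2

open Classical in
/-- The edges, modulo two, at which a function on darts takes different values on both sides. -/
noncomputable def jump (_ : FacedMap G F) (s : G.Dart → ZMod 2) (v w : V) : ZMod 2 :=
  if h : G.Adj v w then s ⟨(v, w), h⟩ + s ⟨(w, v), h.symm⟩ else 0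

theorem jump_comm (s : G.Dart → ZMod 2) (v w : V) : M.jump s v w = M.jump s w v := by
  unfold jump
  by_cases h : G.Adj v w
  · rw [dif_pos h, dif_pos h.symm, add_comm]
  · rw [dif_neg h, dif_neg fun h' => h h'.symm]

theorem jump_dart (s : G.Dart → ZMod 2) (d : G.Dart) :
    M.jump s d.fst d.snd = s d + s d.symm := dif_pos d.adj

theorem adj_of_jump_ne_zero {s : G.Dart → ZMod 2} {v w : V} (h : M.jump s v w ≠ 0) :
    G.Adj v w := by
  by_contra hn
  exact h (dif_neg hn)

/-- Since `s` is constant on facial walks, `s d.symm = s (M.rot d)`. Rotation permutes the darts at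
`v`, so every value is counted twice. -/
theorem sum_jump [Fintype V] {s : G.Dart → ZMod 2} (hs : ∀ d, s (M.facialPerm d) = s d) (v : V) :
    ∑ w, M.jump s v w = 0 := by
  classical
  have : Finite G.Dart := Finite.of_injective _ SimpleGraph.Dart.toProd_injective
  have := Fintype.ofFinite G.Dart
  have h1 : ∑ w, M.jump s v w = ∑ d : G.Dart with d.fst = v, (s d + s d.symm) := by
    rw [← Finset.sum_fiberwise_of_maps_to (t := Finset.univ) (g := fun d : G.Dart => d.snd)
      (fun _ _ => Finset.mem_univ _)]
    refine Finset.sum_congr rfl fun w _ => ?_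
    by_cases h : G.Adj v w
    · rw [Finset.sum_eq_single_of_mem (⟨(v, w), h⟩ : G.Dart) (by simp)]
      · exact dif_pos h
      · intro d hd hne
        simp only [Finset.mem_filter, Finset.mem_univ, true_and] at hd
        exact absurd (SimpleGraph.Dart.ext _ _ (Prod.ext hd.1 hd.2)) hne
    · rw [Finset.sum_eq_zero]
      · exact dif_neg h
      · intro d hd
        simp only [Finset.mem_filter, Finset.mem_univ, true_and] at hd
        exact absurd d.adj (by rwa [hd.1, hd.2])
  have h2 : ∑ d : G.Dart with d.fst = v, s d.symm = ∑ d : G.Dart with d.fst = v, s d := by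
    refine Finset.sum_equiv M.rot (by simp [M.rot_fst]) fun d _ => ?_
    rw [← hs, facialPerm_apply, SimpleGraph.Dart.symm_symm]
  rw [h1, Finset.sum_add_distrib, h2, CharTwo.add_self_eq_zero]

/-! ### The forest left by deleting a dual star. -/

/-- `e` selects for each face `f ≠ o` a dart running along `f` whose reverse runs along `o`. -/
def Separates (o : F) (e : F → G.Dart) : Prop :=
  ∀ f, f ≠ o → M.face (e f) = f ∧ M.face (e f).symm = o

/-- The graph without the edges selected by `e`. -/
def cut (_ : FacedMap G F) (o : F) (e : F → G.Dart) : SimpleGraph V :=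
  G.deleteEdges ((fun f => (e f).edge) '' {o}ᶜ)

variable {M} {o : F} {e : F → G.Dart}

theorem cut_adj {v w : V} :
    (M.cut o e).Adj v w ↔ G.Adj v w ∧ ∀ f, f ≠ o → (e f).edge ≠ s(v, w) := by
  simp [cut, SimpleGraph.deleteEdges_adj]

/-- The vertices of the facial walk containing the dart selected for `f`. -/
def facialSet (M : FacedMap G F) (e : F → G.Dart) (f : F) : Set V :=
  {v | ∃ d : G.Dart, d.fst = v ∧ M.facialPerm.SameCycle d (e f)}

theorem mem_facialSet_self (f : F) : (e f).fst ∈ M.facialSet e f := ⟨_, rfl, .refl _ _⟩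

/-- A selected edge has `o` on one side and its own face on the other, so a walk along `f` meets
only `e f`. -/
theorem Separates.cut_adj_of_sameCycle (he : M.Separates o e) {f : F} (hf : f ≠ o) {d : G.Dart}
    (hd : M.facialPerm.SameCycle d (e f)) (hne : d ≠ e f) : (M.cut o e).Adj d.fst d.snd := by
  refine cut_adj.2 ⟨d.adj, fun g hg h => ?_⟩
  have hface := M.face_eq_of_sameCycle hd
  rw [(he f hf).1] at hface
  rcases (SimpleGraph.dart_edge_eq_iff _ _).1 (h : (e g).edge = d.edge) with h | h
  · rw [← h, (he g hg).1] at hface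
    exact hne (by rw [← h, hface])
  · rw [← d.symm_symm, ← h, (he g hg).2] at hface
    exact hf hface.symm

theorem Separates.facialSet_induction [Finite V] (he : M.Separates o e) {f : F} (hf : f ≠ o)
    {p : V → Prop}
    (hp : ∀ a ∈ M.facialSet e f, ∀ b ∈ M.facialSet e f, (M.cut o e).Adj a b → (p a ↔ p b))
    {v : V} (hv : v ∈ M.facialSet e f) : p v ↔ p (e f).fst := by
  have : Finite G.Dart := Finite.of_injective _ SimpleGraph.Dart.toProd_injective
  obtain ⟨d, rfl, hd⟩ := hv
  obtain ⟨n, -, hn⟩ := hd.exists_pow_eq'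
  induction n generalizing d with
  | zero => rw [show d = e f from hn]
  | succ n ih =>
    by_cases hne : d = e f
    · rw [hne]
    · rw [pow_succ, Equiv.Perm.mul_apply] at hn
      have hd' : M.facialPerm.SameCycle (M.facialPerm d) (e f) :=
        Equiv.Perm.sameCycle_apply_left.2 hd
      refine (hp _ ⟨d, rfl, hd⟩ _ ⟨_, rfl, hd'⟩ ?_).trans (ih _ hd' hn)
      rw [facialPerm_fst]
      exact he.cut_adj_of_sameCycle hf hd hne

theorem Separates.connectedOn_facialSet [Finite V] (he : M.Separates o e) {f : F} (hf : f ≠ o) :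
    (M.cut o e).ConnectedOn (M.facialSet e f) := by
  rintro A hA ⟨x, hx⟩ hcl
  have key : ∀ v ∈ M.facialSet e f, (v ∈ A ↔ (e f).fst ∈ A) := fun v hv =>
    he.facialSet_induction hf (p := (· ∈ A))
      (fun a ha b hb hab => ⟨fun h => hcl a h b hb hab, fun h => hcl b h a ha hab.symm⟩) hv
  exact fun v hv => (key v hv).2 ((key x (hA hx)).1 hx)

/-- The rest of the facial walk is a detour around the deleted edge `e f`. -/
theorem Separates.cut_reachable [Finite V] (he : M.Separates o e) {v w : V} (h : G.Adj v w) :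
    (M.cut o e).Reachable v w := by
  by_cases hc : (M.cut o e).Adj v w
  · exact hc.reachable
  have key : ∀ f, f ≠ o → (M.cut o e).Reachable (e f).snd (e f).fst := by
    intro f hf
    refine (he.facialSet_induction hf (p := fun x => (M.cut o e).Reachable x (e f).fst)
      (fun a _ b _ hab => ⟨hab.symm.reachable.trans, hab.reachable.trans⟩)
      ⟨M.facialPerm (e f), M.facialPerm_fst _, ?_⟩).2 .rfl
    exact Equiv.Perm.sameCycle_apply_left.2 (.refl _ _)
  rw [cut_adj] at hc
  push Not at hc
  obtain ⟨f, hf, hfe⟩ := hc h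
  rcases SimpleGraph.dart_edge_eq_mk'_iff'.1 hfe with ⟨rfl, rfl⟩ | ⟨rfl, rfl⟩
  · exact (key f hf).symm
  · exact key f hf

theorem Separates.injOn_edge (he : M.Separates o e) :
    Set.InjOn (fun f => (e f).edge) {o}ᶜ := by
  intro f hf g hg h
  rcases (SimpleGraph.dart_edge_eq_iff _ _).1 h with h | h
  · rw [← (he f hf).1, h, (he g hg).1]
  · exact absurd (show f = o by rw [← (he f hf).1, h, (he g hg).2]) hf

/-- Modulo two, a cycle of `G` without selected edges is zero. -/
theorem eq_zero_of_cut_isAcyclic [Fintype V] (hT : (M.cut o e).IsAcyclic)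
    {z : V → V → ZMod 2} (hsymm : ∀ v w, z v w = z w v) (hsupp : ∀ v w, z v w ≠ 0 → G.Adj v w)
    (hsum : ∀ v, ∑ w, z v w = 0) (he : ∀ f, f ≠ o → z (e f).fst (e f).snd = 0) (v w : V) :
    z v w = 0 := by
  refine hT.eq_zero_of_sum_eq_zero z hsymm (fun v w h => cut_adj.2 ⟨hsupp v w h, ?_⟩) hsum v w
  intro f hf hfe
  have := he f hf
  rcases SimpleGraph.dart_edge_eq_mk'_iff'.1 hfe with ⟨rfl, rfl⟩ | ⟨rfl, rfl⟩
  · exact h this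
  · exact h (by rwa [hsymm])

/-- An edge with the face `f ≠ o` on exactly one side belongs to the facial walk of `e f`. -/
theorem Separates.sameCycle [Finite V] (he : M.Separates o e) (hT : (M.cut o e).IsAcyclic)
    {d : G.Dart} (hd : M.face d ≠ o) (hd' : M.face d.symm ≠ M.face d) :
    M.facialPerm.SameCycle d (e (M.face d)) := by
  classical
  have := Fintype.ofFinite V
  by_contra hn
  -- If the facial walk of `d` missed `e (M.face d)`, the jump of its indicator would be a cycle
  -- inside the forest, hence zero, yet it is one at `d`.
  let s : G.Dart → ZMod 2 := fun d' => if M.facialPerm.SameCycle d d' then 1 else 0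
  have hs : ∀ d', s (M.facialPerm d') = s d' := fun d' => by
    simp only [s, Equiv.Perm.sameCycle_apply_right]
  have hs0 : ∀ d', M.face d' ≠ M.face d → s d' = 0 := fun d' h =>
    if_neg fun h' => h (M.face_eq_of_sameCycle h').symm
  have h0 := eq_zero_of_cut_isAcyclic hT (M.jump_comm s) (fun _ _ => M.adj_of_jump_ne_zero)
    (M.sum_jump hs) (fun f hf => by
      rw [jump_dart, hs0 (e f).symm (by rw [(he f hf).2]; exact hd.symm), add_zero]
      by_cases hfd : f = M.face d
      · rw [hfd]; exact if_neg hn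
      · exact hs0 _ (by rwa [(he f hf).1])) d.fst d.snd
  rw [jump_dart, hs0 _ hd', add_zero] at h0
  exact one_ne_zero ((if_pos (.refl _ _)).symm.trans h0)

/-- A vertex on the boundaries of `f ≠ o` and of another face is on the facial walk of `e f`. -/
theorem Separates.mem_facialSet [Finite V] (he : M.Separates o e) (hT : (M.cut o e).IsAcyclic)
    {f g : F} (hf : f ≠ o) (hfg : f ≠ g) {v : V} (hvf : M.Incident v f) (hvg : M.Incident v g) :
    v ∈ M.facialSet e f := by
  rcases hvf with ⟨d, hd, hdf⟩ | ⟨h, hi⟩ <;> rcases hvg with ⟨d', hd', hdg⟩ | ⟨h', hi'⟩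
  · by_contra hv
    -- Off the facial walk of `e f`, rotating at `v` never leaves `f`, so `g` could not occur there.
    refine hfg (Eq.trans (M.rot_induction (p := fun d => M.face d = f) ?_ hd hd' hdf).symm hdg)
    intro a ha haf
    rw [face_rot]
    by_contra hne
    refine hv ⟨a, ha, ?_⟩
    have := he.sameCycle hT (d := a) (haf ▸ hf) (haf.symm ▸ hne)
    rwa [haf] at this
  · exact absurd (hd ▸ d.adj) (h' _)
  · exact absurd (hd' ▸ d'.adj) (h _)
  · exact absurd (hi.symm.trans hi') hfg

/-- A cycle has two sides: each face is inside (1) or outside (0), `o` is outside, and exactly the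
edges of the cycle have different sides. -/
theorem Separates.exists_side [Finite V] (he : M.Separates o e) (hT : (M.cut o e).IsAcyclic)
    {x : V} {c : G.Walk x x} (hc : c.IsCycle) :
    ∃ s : F → ZMod 2, s o = 0 ∧ (∀ f, s f ≠ 0 → (e f).edge ∈ c.edges) ∧
      ∀ d : G.Dart, d.edge ∈ c.edges ↔ s (M.face d) ≠ s (M.face d.symm) := by
  classical
  have := Fintype.ofFinite V
  -- The edge `e f` to the outer face `o` forces the side of `f`. The cycle plus the jump of `s`
  -- then vanishes on selected edges, hence everywhere.
  let s : F → ZMod 2 := fun f => if f ≠ o ∧ (e f).edge ∈ c.edges then 1 else 0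
  let y : V → V → ZMod 2 := fun v w => if c.toSubgraph.Adj v w then 1 else 0
  have hsum : ∀ v, ∑ w, y v w = 0 := by
    intro v
    simp only [y, Finset.sum_boole]
    by_cases hv : v ∈ c.support
    · have h2 := hc.ncard_neighborSet_toSubgraph_eq_two hv
      have : (Finset.univ.filter fun w => c.toSubgraph.Adj v w).card = 2 := by
        rw [← h2, ← Set.ncard_coe_finset]
        congr 1
        ext; simp
      rw [this]; rfl
    · rw [Finset.filter_false_of_mem]
      · simp
      · intro w _ h
        exact hv (by simpa using h.fst_mem)
  have h0 := eq_zero_of_cut_isAcyclic hT (z := fun v w => y v w + M.jump (s ∘ M.face) v w)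
    (fun v w => by simp only [y, M.jump_comm _ v w, c.toSubgraph.adj_comm v w])
    (fun v w h => by
      by_contra hn
      refine h ?_
      rw [jump, dif_neg hn, add_zero]
      exact if_neg fun h' => hn h'.adj_sub)
    (fun v => by
      rw [Finset.sum_add_distrib, hsum, M.sum_jump, add_zero]
      intro d
      simp [facialPerm_apply, M.face_next])
    (fun f hf => by
      simp only [jump_dart, Function.comp, (he f hf).1, (he f hf).2]
      simp only [y, s, SimpleGraph.Walk.adj_toSubgraph_iff_mem_edges, SimpleGraph.Dart.edge]
      by_cases h : s((e f).fst, (e f).snd) ∈ c.edges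
      · simp [h, hf]; rfl
      · simp [h])
  refine ⟨s, by simp [s], fun f hf => ?_, fun d => ?_⟩
  · by_contra h
    exact hf (by simp [s, h])
  · have := h0 d.fst d.snd
    simp only [jump_dart, Function.comp, y, SimpleGraph.Walk.adj_toSubgraph_iff_mem_edges] at this
    rw [SimpleGraph.Dart.edge]
    generalize s (M.face d) = a at *
    generalize s (M.face d.symm) = b at *
    by_cases h : s(d.fst, d.snd) ∈ c.edges
    · simp only [h, if_true, true_iff] at this ⊢
      revert this; revert a b; decide
    · simp only [h, if_false, false_iff] at this ⊢
      revert this; revert a b; decide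

end FacedMap

/-! ### Euler's formula and the bound. -/

/-- Exactly `|F| - 1` distinct edges are deleted without adding components, so Euler's formula
leaves too few edges for a cycle. -/
theorem PlaneEmbedding.cut_isAcyclic {V F : Type*} [Finite V] [Finite F] {G : SimpleGraph V}
    (M : PlaneEmbedding G F) {o : F} {e : F → G.Dart} (he : M.Separates o e) :
    (M.cut o e).IsAcyclic := by
  apply SimpleGraph.isAcyclic_of_card_edgeSet_add_card_le
  have h1 : Nat.card (M.cut o e).ConnectedComponent ≤ Nat.card G.ConnectedComponent :=
    SimpleGraph.card_connectedComponent_le_of_reachable (SimpleGraph.deleteEdges_le _)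
      fun a b hab => he.cut_reachable hab
  have h2 : ((fun f => (e f).edge) '' {o}ᶜ).ncard + 1 = Nat.card F := by
    rw [he.injOn_edge.ncard_image, ← Set.ncard_singleton o, add_comm,
      Set.ncard_add_ncard_compl]
  have h3 : Nat.card (M.cut o e).edgeSet + ((fun f => (e f).edge) '' {o}ᶜ).ncard
      = Nat.card G.edgeSet := by
    rw [FacedMap.cut, SimpleGraph.edgeSet_deleteEdges]
    exact Set.ncard_sdiff_add_ncard_of_subset
      (by rintro _ ⟨f, -, rfl⟩; exact (e f).edge_mem) (Set.toFinite _)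
  have := M.euler
  omega

theorem PlaneEmbedding.card_le_fp {V F : Type*} [Finite F] {G : SimpleGraph V}
    (M : PlaneEmbedding G F) {o : F} {P : Finset F} (hP : M.IsFacePacking o P) :
    P.card ≤ M.fp o := by
  refine le_csSup ⟨Nat.card F, ?_⟩ ⟨P, hP, rfl⟩
  rintro n ⟨Q, -, rfl⟩
  rw [← Set.ncard_coe_finset]
  exact Set.ncard_le_card _

theorem SimpleGraph.fvs_le_card {V : Type*} {G : SimpleGraph V} {S : Finset V}
    (hS : G.IsFeedbackVertexSet S) : G.fvs ≤ S.card := Nat.sInf_le ⟨S, hS, rfl⟩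

theorem mainTheorem3 {V F : Type*} [Finite V] [Finite F] (G : SimpleGraph V)
    (M : PlaneEmbedding G F) (o : F) (ho : M.IsBase o) :
    G.fvs ≤ 2 * M.fp o := by
  classical
  have := Fintype.ofFinite V
  by_cases hE : Nonempty G.Dart
  swap
  · have : G.IsFeedbackVertexSet ∅ := by
      intro v c hc
      refine hE ⟨⟨(v.1, (c.snd).1), ?_⟩⟩
      exact c.adj_snd hc.not_nil
    exact (SimpleGraph.fvs_le_card this).trans (by simp)
  have hV : Nonempty V := ⟨hE.some.fst⟩
  -- The value of `e` at `o` is an arbitrary dart.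
  have hex : ∀ f, ∃ d : G.Dart, f ≠ o → M.face d = f ∧ M.face d.symm = o := by
    intro f
    by_cases hf : f = o
    · exact ⟨hE.some, fun h => absurd hf h⟩
    · obtain ⟨d, h1, h2⟩ := ho f hf
      exact ⟨d.symm, fun _ => ⟨h2, by simpa using h1⟩⟩
  choose e hsep using hex
  have he : M.Separates o e := hsep
  have hT := M.cut_isAcyclic he
  obtain ⟨P, t, hPI, ht, hdis, hcov⟩ := hT.exists_packing_covering Finset.univ {o}ᶜ
    (M.facialSet e) fun f hf =>
      ⟨by simp, ⟨_, FacedMap.mem_facialSet_self f⟩, he.connectedOn_facialSet hf⟩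
  have hpack : M.IsFacePacking o P := by
    refine ⟨fun h => hPI h rfl, fun f hf g hg hfg => Set.disjoint_left.2 fun v hvf hvg => ?_⟩
    exact Set.disjoint_left.1 (hdis f hf g hg hfg) (he.mem_facialSet hT (hPI hf) hfg hvf hvg)
      (he.mem_facialSet hT (hPI hg) hfg.symm hvg hvf)
  have hfvs : G.IsFeedbackVertexSet (P.image t ∪ P.image fun f => (e f).fst) := by
    intro v c' hc'
    let ι := SimpleGraph.Embedding.induce (G := G)
      {v | v ∉ P.image t ∪ P.image fun f => (e f).fst}
    have hc : (c'.map ι.toHom).IsCycle := hc'.map ι.injective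
    have hav : ∀ w ∈ (c'.map ι.toHom).support,
        w ∉ P.image t ∪ P.image fun f => (e f).fst := by
      intro w hw
      rw [SimpleGraph.Walk.support_map, List.mem_map] at hw
      obtain ⟨u, -, rfl⟩ := hw
      exact u.2
    generalize c'.map ι.toHom = c at hc hav
    obtain ⟨s, hso, hse, hs⟩ := he.exists_side hT hc
    obtain ⟨g, hg⟩ : ∃ g, s g ≠ 0 := by
      by_contra! h
      have := (hs ⟨(_, c.snd), c.adj_snd hc.not_nil⟩).1 (c.mk_start_snd_mem_edges hc.not_nil)
      simp [h] at this
    have hgo : g ≠ o := fun h => hg (h ▸ hso)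
    obtain ⟨j, hj, d, hd, hdg⟩ := hcov g hgo
    obtain ⟨d', hd', hdj⟩ := ht j hj
    have hdg := (M.face_eq_of_sameCycle hdg).trans (he g hgo).1
    have hdj := (M.face_eq_of_sameCycle hdj).trans (he j (hPI hj)).1
    -- The cycle uses no edge at `t j`, so rotating there never changes sides.
    have hsj : s (M.face d') ≠ 0 := by
      refine M.rot_induction (p := fun d => s (M.face d) ≠ 0) ?_ hd hd' (hdg ▸ hg)
      intro a ha h
      have hac : a.edge ∉ c.edges := fun hac =>
        hav _ (c.fst_mem_support_of_mem_edges hac) (by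
          rw [ha]
          exact Finset.mem_union_left _ (Finset.mem_image_of_mem t hj))
      rw [hs a, not_not] at hac
      rwa [FacedMap.face_rot, ← hac]
    rw [hdj] at hsj
    exact hav _ (c.fst_mem_support_of_mem_edges (hse j hsj))
      (Finset.mem_union_right _ (Finset.mem_image_of_mem (fun f => (e f).fst) hj))
  calc G.fvs ≤ _ := SimpleGraph.fvs_le_card hfvs
    _ ≤ P.card + P.card :=
      (Finset.card_union_le _ _).trans (add_le_add Finset.card_image_le Finset.card_image_le)
    _ ≤ 2 * M.fp o := by have := M.card_le_fp hpack; omega
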